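/- For $x\in\mathbb R$ and an integer $\nu\ge 0$ let $$I_\nu(x)=\sum_{k\ge 0}\frac{(x/2)^{2k+\nu}}{k!\,\Gamma(k+\nu+1)},\qquad \mathbf L_\nu(x)=\sum_{k\ge 0}\frac{(x/2)^{2k+\nu+1}}{\Gamma(k+\frac32)\,\Gamma(k+\nu+\frac32)}$$ be the modified Bessel and modified Struve functions of the first kind, and let ${}_2F_3$ denote the generalized hypergeometric function. Let $V>0$. For a Bond number $B>0$, put $\kappa=\sqrt B$ and $$\Upsilon(\kappa)=I_1(\kappa)\mathbf L_0(\kappa)-I_0(\kappa)\mathbf L_1(\kappa),\qquad d_0=d_0(B)=\frac{3\pi\Upsilon(\kappa)+2B\,I_0(\kappa)-6\kappa\,I_1(\kappa)}{3B\,I_2(\kappa)}.$$ In the isoperimetric sloshing problem with surface tension and pinned contact line, for shallow radially symmetric containers of unit rim radius and volume $V$ and purely radial motion ($m=0$), let $\lambda^*_{0,1}$ (the optimal squared fundamental frequency) and $h^*_0$ (the optimal profile, a function of $r\in[0,1]$) be given by the explicit formulas $$\lambda^*_{0,1}(B)=\frac{18V}{\pi}\left[6d_0-3+\frac{18(1-d_0)\pi\Upsilon(\kappa)}{B\,I_0(\kappa)}+3\,{}_2F_3\!\left(1,2;\tfrac32,\tfrac52,3;\tfrac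 B4\right)-\frac{9\pi^2\mathbf L_0(\kappa)\Upsilon(\kappa)}{B^{3/2}I_0(\kappa)}\right]^{-1},$$ $$h^*_0(B;r)=\frac{\lambda^*_{0,1}(B)}{3}\left[\frac{3d_0r}{2}-r^2\right]+\frac{\lambda^*_{0,1}(B)(1-d_0)I_1(\kappa r)}{\kappa\,I_0(\kappa)}+\frac{\lambda^*_{0,1}(B)\,\pi}{2B}\left[\mathbf L_1(\kappa r)-\frac{\mathbf L_0(\kappa)I_1(\kappa r)}{I_0(\kappa)}\right].$$ Then $\lambda^*_{0,1}(B)\to \dfrac{18V}{\pi}$ as $B\to\infty$. Moreover, for every $r\in[0,1]$, $h^*_0(B;r)\to\dfrac{6V(r-r^2)}{\pi}$ as $B\to\infty$. -/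

import Mathlib

noncomputable section

namespace Sloshing

open Real

/-- The modified Bessel function of the first kind `I_ν` of integer order `ν ≥ 0`, through its
everywhere convergent power series `I_ν(x) = ∑ₖ (x/2)^(2k+ν) / (k! Γ(k+ν+1))`. -/
def besselI (ν : ℕ) (x : ℝ) : ℝ :=
  ∑' k : ℕ, (x / 2) ^ (2 * k + ν) / ((k.factorial : ℝ) * Gamma ((k : ℝ) + (ν : ℝ) + 1))

/-- The modified Struve function of the first kind `L_ν` of integer order `ν ≥ 0`, through its
everywhere convergent power series
`L_ν(x) = ∑ₖ (x/2)^(2k+ν+1) / (Γ(k+3/2) Γ(k+ν+3/2))`. -/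
def struveL (ν : ℕ) (x : ℝ) : ℝ :=
  ∑' k : ℕ, (x / 2) ^ (2 * k + ν + 1) /
    (Gamma ((k : ℝ) + 3 / 2) * Gamma ((k : ℝ) + (ν : ℝ) + 3 / 2))

/-- The rising factorial `(a)_k = a (a+1) ⋯ (a+k-1)`. -/
def risingFactorial (a : ℝ) (k : ℕ) : ℝ :=
  ∏ i ∈ Finset.range k, (a + (i : ℝ))

/-- The generalized hypergeometric function
`ₚF_q(a₁,…,aₚ; b₁,…,b_q; z) = ∑ₖ ((a₁)_k ⋯ (aₚ)_k) / ((b₁)_k ⋯ (b_q)_k) · z^k / k!`,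
with the parameters given as lists. -/
def hypergeometricPFQ (a b : List ℝ) (z : ℝ) : ℝ :=
  ∑' k : ℕ, (a.map fun c => risingFactorial c k).prod /
    (b.map fun c => risingFactorial c k).prod * (z ^ k / (k.factorial : ℝ))

/-- `Υ(κ) = I₁(κ) L₀(κ) - I₀(κ) L₁(κ)`. -/
def upsilon (κ : ℝ) : ℝ :=
  besselI 1 κ * struveL 0 κ - besselI 0 κ * struveL 1 κ

/-- The constant `d₀`, as a function of the Bond number `B`. -/
def dZero (B : ℝ) : ℝ :=
  (3 * π * upsilon (√B) + 2 * B * besselI 0 (√B) - 6 * √B * besselI 1 (√B)) /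
    (3 * B * besselI 2 (√B))

/-- The maximal squared fundamental sloshing frequency `λ*_{0,1}` (for `m = 0`) of shallow radially
symmetric containers of volume `V`, at Bond number `B`. -/
def lambdaStar (V B : ℝ) : ℝ :=
  18 * V / π *
    (6 * dZero B - 3
      + 18 * (1 - dZero B) * π * upsilon (√B) / (B * besselI 0 (√B))
      + 3 * hypergeometricPFQ [1, 2] [3 / 2, 5 / 2, 3] (B / 4)
      - 9 * π ^ 2 * struveL 0 (√B) * upsilon (√B) / (B ^ (3 / 2 : ℝ) * besselI 0 (√B)))⁻¹

/-- The corresponding optimal container shape `h*₀` (for `m = 0`) of volume `V` at Bond number `B`,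
as a function of the radius `r`. -/
def hStar (V B r : ℝ) : ℝ :=
  lambdaStar V B / 3 * (3 * dZero B * r / 2 - r ^ 2)
    + lambdaStar V B * (1 - dZero B) * besselI 1 (√B * r) / (√B * besselI 0 (√B))
    + lambdaStar V B * π / (2 * B) *
      (struveL 1 (√B * r) - struveL 0 (√B) * besselI 1 (√B * r) / besselI 0 (√B))

end Sloshing

end

noncomputable section

open Real

namespace Sloshing

theorem summable_of_abs_le_div_factorial {a : ℕ → ℝ} {C : ℝ}
    (ha : ∀ k, |a k| ≤ C / (k.factorial : ℝ)) (m : ℕ) (x : ℝ) :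
    Summable fun k => a k * x ^ (2 * k + m) := by
  refine Summable.of_norm_bounded
    (g := fun k => C * |x| ^ m * ((x ^ 2) ^ k / (k.factorial : ℝ)))
    ((Real.summable_pow_div_factorial (x ^ 2)).mul_left _) fun k => ?_
  have h : |x| ^ (2 * k + m) = |x| ^ m * (x ^ 2) ^ k := by
    rw [pow_add, pow_mul, sq_abs]; ring
  rw [Real.norm_eq_abs, abs_mul, abs_pow, h]
  calc |a k| * (|x| ^ m * (x ^ 2) ^ k) ≤ C / (k.factorial : ℝ) * (|x| ^ m * (x ^ 2) ^ k) :=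
        mul_le_mul_of_nonneg_right (ha k) (by positivity)
    _ = _ := by ring

/-- The derivative of an entire power series whose exponents all have the same parity. -/
theorem hasDerivAt_tsum_of_abs_le_div_factorial {a : ℕ → ℝ} {C : ℝ}
    (ha : ∀ k, |a k| ≤ C / (k.factorial : ℝ)) (m : ℕ) (x : ℝ) :
    HasDerivAt (fun y => ∑' k, a k * y ^ (2 * k + m))
      (∑' k, a k * ((2 * k + m : ℕ) * x ^ (2 * k + m - 1))) x := by
  obtain ⟨R, hR1, hR⟩ : ∃ R : ℝ, 1 ≤ R ∧ |x| < R :=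
    ⟨|x| + 1, by linarith [abs_nonneg x], by linarith⟩
  have hC : 0 ≤ C := by simpa using (abs_nonneg _).trans (ha 0)
  refine hasDerivAt_tsum_of_isPreconnected
    (u := fun k => C * (2 + m) * R ^ m * ((2 * R ^ 2) ^ k / (k.factorial : ℝ)))
    (g' := fun k y => a k * ((2 * k + m : ℕ) * y ^ (2 * k + m - 1)))
    ((Real.summable_pow_div_factorial (2 * R ^ 2)).mul_left _)
    (t := Metric.ball 0 R) Metric.isOpen_ball (convex_ball 0 R).isPreconnected
    (fun k y _ => (hasDerivAt_pow _ y).const_mul _) (fun k y hy => ?_)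
    (y₀ := 0) (by simpa using by linarith) (summable_of_abs_le_div_factorial ha m 0)
    (by simpa using hR)
  have hy' : |y| ≤ R := by simpa using (Metric.mem_ball.1 hy).le
  have h1 : ((2 * k + m : ℕ) : ℝ) ≤ (2 + m) * 2 ^ k := by
    have : (k : ℝ) + 1 ≤ 2 ^ k := by exact_mod_cast k.lt_two_pow_self
    have hk : (0 : ℝ) ≤ k := k.cast_nonneg
    have hm : (0 : ℝ) ≤ m := m.cast_nonneg
    push_cast
    nlinarith
  have h2 : |y| ^ (2 * k + m - 1) ≤ R ^ m * (R ^ 2) ^ k := by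
    calc |y| ^ (2 * k + m - 1) ≤ R ^ (2 * k + m - 1) := pow_le_pow_left₀ (abs_nonneg y) hy' _
      _ ≤ R ^ (2 * k + m) := pow_le_pow_right₀ hR1 (Nat.sub_le _ _)
      _ = _ := by rw [pow_add, pow_mul]; ring
  rw [Real.norm_eq_abs, abs_mul, abs_mul, abs_pow, Nat.abs_cast]
  calc |a k| * ((2 * k + m : ℕ) * |y| ^ (2 * k + m - 1))
      ≤ C / (k.factorial : ℝ) * ((2 + m) * 2 ^ k * (R ^ m * (R ^ 2) ^ k)) := by
        have := ha k
        gcongr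
    _ = _ := by rw [mul_pow]; ring

theorem hasDerivAt_tsum_even {a : ℕ → ℝ} {C : ℝ}
    (ha : ∀ k, |a k| ≤ C / (k.factorial : ℝ)) (x : ℝ) :
    HasDerivAt (fun y => ∑' k, a k * y ^ (2 * k))
      (∑' k : ℕ, (2 * k + 2) * a (k + 1) * x ^ (2 * k + 1)) x := by
  have hb : ∀ k, |a (k + 1)| ≤ C / (k.factorial : ℝ) := fun k => by
    have hC : 0 ≤ C := by simpa using (abs_nonneg _).trans (ha 0)
    refine (ha (k + 1)).trans ?_
    gcongr
    exact k.le_succ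
  have h := (hasDerivAt_tsum_of_abs_le_div_factorial hb 2 x).const_add (a 0)
  have e1 : (fun y => ∑' k, a k * y ^ (2 * k)) =
      fun y => a 0 + ∑' k, a (k + 1) * y ^ (2 * k + 2) := by
    funext y
    have hs : Summable fun k => a k * y ^ (2 * k) := by
      simpa using summable_of_abs_le_div_factorial ha 0 y
    rw [hs.tsum_eq_zero_add]
    simp [mul_add]
  rw [e1]
  refine h.congr_deriv (tsum_congr fun k => ?_)
  push_cast
  ring

/-- The coefficients of the power series of `besselI ν`. -/
def coeffI (ν k : ℕ) : ℝ :=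
  1 / (2 ^ (2 * k + ν) * ((k.factorial : ℝ) * ((k + ν).factorial : ℝ)))

/-- The coefficients of the power series of `struveL ν`. -/
def coeffL (ν k : ℕ) : ℝ :=
  1 / (2 ^ (2 * k + ν + 1) * (Gamma ((k : ℝ) + 3 / 2) * Gamma ((k : ℝ) + (ν : ℝ) + 3 / 2)))

theorem besselI_eq_tsum (ν : ℕ) (x : ℝ) :
    besselI ν x = ∑' k, coeffI ν k * x ^ (2 * k + ν) := by
  refine tsum_congr fun k => ?_
  have : Gamma ((k : ℝ) + (ν : ℝ) + 1) = ((k + ν).factorial : ℝ) := by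
    rw [← Real.Gamma_nat_eq_factorial]; push_cast; rfl
  rw [this, coeffI, div_pow]
  field_simp

theorem struveL_eq_tsum (ν : ℕ) (x : ℝ) :
    struveL ν x = ∑' k, coeffL ν k * x ^ (2 * k + (ν + 1)) := by
  refine tsum_congr fun k => ?_
  rw [coeffL, div_pow, ← add_assoc]
  have h1 : Gamma ((k : ℝ) + 3 / 2) ≠ 0 := (Real.Gamma_pos_of_pos (by positivity)).ne'
  have h2 : Gamma ((k : ℝ) + ν + 3 / 2) ≠ 0 := (Real.Gamma_pos_of_pos (by positivity)).ne'
  field_simp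

theorem coeffI_nonneg (ν k : ℕ) : 0 ≤ coeffI ν k := by
  unfold coeffI; positivity

theorem abs_coeffI_le (ν k : ℕ) : |coeffI ν k| ≤ 1 / (k.factorial : ℝ) := by
  rw [abs_of_nonneg (coeffI_nonneg ν k), coeffI]
  have h1 : (1 : ℝ) ≤ 2 ^ (2 * k + ν) := one_le_pow₀ (by norm_num)
  have h2 : (1 : ℝ) ≤ ((k + ν).factorial : ℝ) := by exact_mod_cast Nat.factorial_pos _
  have h3 : (0 : ℝ) < (k.factorial : ℝ) := by positivity
  gcongr
  calc (k.factorial : ℝ) = 1 * (k.factorial * 1) := by ring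
    _ ≤ _ := by gcongr

theorem Gamma_three_halves : Gamma (3 / 2 : ℝ) = √π / 2 := by
  rw [show (3 / 2 : ℝ) = 1 / 2 + 1 by norm_num, Real.Gamma_add_one (by norm_num),
    Real.Gamma_one_half_eq]
  ring

theorem factorial_div_two_le_Gamma (k : ℕ) :
    (k.factorial : ℝ) / 2 ≤ Gamma ((k : ℝ) + 3 / 2) := by
  induction k with
  | zero =>
    simp only [Nat.factorial_zero, Nat.cast_one, Nat.cast_zero, zero_add, Gamma_three_halves]
    have : 1 ≤ √π := Real.one_le_sqrt.2 (by linarith [Real.pi_gt_three])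
    linarith
  | succ k ih =>
    rw [Nat.factorial_succ]
    push_cast
    rw [show (k : ℝ) + 1 + 3 / 2 = (k + 3 / 2) + 1 by ring, Real.Gamma_add_one (by positivity)]
    have : (0 : ℝ) ≤ k.factorial := by positivity
    have hk : (0 : ℝ) ≤ k := k.cast_nonneg
    calc ((k : ℝ) + 1) * k.factorial / 2 = (k + 1) * (k.factorial / 2) := by ring
      _ ≤ (k + 3 / 2) * Gamma (k + 3 / 2) := by gcongr; norm_num

theorem abs_coeffL_le (ν k : ℕ) : |coeffL ν k| ≤ 4 / (k.factorial : ℝ) := by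
  have h1 : (1 : ℝ) ≤ 2 ^ (2 * k + ν + 1) := one_le_pow₀ (by norm_num)
  have h2 := factorial_div_two_le_Gamma k
  have h3 : (1 : ℝ) / 2 ≤ Gamma ((k : ℝ) + ν + 3 / 2) := by
    have := factorial_div_two_le_Gamma (k + ν)
    have h : (1 : ℝ) ≤ ((k + ν).factorial : ℝ) := by exact_mod_cast Nat.factorial_pos _
    push_cast at this
    linarith
  have h4 : (0 : ℝ) < (k.factorial : ℝ) := by positivity
  have h5 : 1 * ((k.factorial : ℝ) / 2 * (1 / 2)) ≤
      2 ^ (2 * k + ν + 1) * (Gamma ((k : ℝ) + 3 / 2) * Gamma ((k : ℝ) + (ν : ℝ) + 3 / 2)) := by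
    gcongr
  rw [coeffL, abs_of_nonneg (one_div_nonneg.2 (le_trans (by positivity) h5))]
  calc _ ≤ 1 / (1 * ((k.factorial : ℝ) / 2 * (1 / 2))) :=
        one_div_le_one_div_of_le (by positivity) h5
    _ = _ := by field_simp; norm_num

theorem hasDerivAt_besselI_zero (x : ℝ) : HasDerivAt (besselI 0) (besselI 1 x) x := by
  have h := hasDerivAt_tsum_even (abs_coeffI_le 0) x
  have e : besselI 0 = fun y => ∑' k, coeffI 0 k * y ^ (2 * k) := by
    funext y; simp [besselI_eq_tsum]
  rw [e, besselI_eq_tsum]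
  refine h.congr_deriv (tsum_congr fun k => ?_)
  simp only [coeffI, Nat.factorial_succ, add_zero]
  push_cast
  field_simp
  ring

theorem hasDerivAt_mul_besselI_one (x : ℝ) :
    HasDerivAt (fun y => y * besselI 1 y) (x * besselI 0 x) x := by
  have h := hasDerivAt_tsum_of_abs_le_div_factorial (abs_coeffI_le 1) 2 x
  have e : (fun y => y * besselI 1 y) = fun y => ∑' k, coeffI 1 k * y ^ (2 * k + 2) := by
    funext y
    rw [besselI_eq_tsum, ← tsum_mul_left]
    exact tsum_congr fun k => by ring
  rw [e, besselI_eq_tsum, ← tsum_mul_left]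
  refine h.congr_deriv (tsum_congr fun k => ?_)
  rw [show 2 * k + 2 - 1 = 2 * k + 1 by omega]
  simp only [coeffI, Nat.factorial_succ, add_zero]
  push_cast
  field_simp
  ring

theorem Gamma_add_five_halves (k : ℕ) :
    Gamma ((k : ℝ) + 1 + 3 / 2) = (k + 3 / 2) * Gamma ((k : ℝ) + 3 / 2) := by
  rw [show (k : ℝ) + 1 + 3 / 2 = (k + 3 / 2) + 1 by ring, Real.Gamma_add_one (by positivity)]

theorem coeffL_zero_zero : coeffL 0 0 = 2 / π := by
  simp only [coeffL, Nat.cast_zero, zero_add, mul_zero, pow_one, add_zero, Gamma_three_halves]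
  have := Real.sq_sqrt Real.pi_pos.le
  have h : √π / 2 * (√π / 2) = π / 4 := by nlinarith
  rw [h]
  field_simp
  norm_num

theorem hasDerivAt_struveL_zero (x : ℝ) :
    HasDerivAt (struveL 0) (struveL 1 x + 2 / π) x := by
  have h := hasDerivAt_tsum_of_abs_le_div_factorial (abs_coeffL_le 0) 1 x
  have e : struveL 0 = fun y => ∑' k, coeffL 0 k * y ^ (2 * k + 1) := by
    funext y; simp [struveL_eq_tsum]
  rw [e, struveL_eq_tsum]
  refine h.congr_deriv ?_
  have hs : Summable fun k : ℕ => coeffL 0 k * ((2 * k + 1 : ℕ) * x ^ (2 * k + 1 - 1)) := by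
    rw [← summable_nat_add_iff 1]
    refine (summable_of_abs_le_div_factorial (abs_coeffL_le 1) 2 x).congr fun k => ?_
    have h1 : Gamma ((k : ℝ) + 3 / 2) ≠ 0 := (Real.Gamma_pos_of_pos (by positivity)).ne'
    simp only [coeffL]
    push_cast
    simp only [add_zero, Gamma_add_five_halves]
    field_simp
    ring
  rw [hs.tsum_eq_zero_add]
  refine (add_comm _ _).trans ?_
  congr 1
  · refine tsum_congr fun k => ?_
    have h1 : Gamma ((k : ℝ) + 3 / 2) ≠ 0 := (Real.Gamma_pos_of_pos (by positivity)).ne'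
    simp only [coeffL]
    push_cast
    simp only [add_zero, Gamma_add_five_halves]
    field_simp
    ring
  · simp [coeffL_zero_zero]

theorem hasDerivAt_mul_struveL_one (x : ℝ) :
    HasDerivAt (fun y => y * struveL 1 y) (x * struveL 0 x) x := by
  have h := hasDerivAt_tsum_of_abs_le_div_factorial (abs_coeffL_le 1) 3 x
  have e : (fun y => y * struveL 1 y) = fun y => ∑' k, coeffL 1 k * y ^ (2 * k + 3) := by
    funext y
    rw [struveL_eq_tsum, ← tsum_mul_left]
    exact tsum_congr fun k => by ring
  rw [e, struveL_eq_tsum, ← tsum_mul_left]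
  refine h.congr_deriv (tsum_congr fun k => ?_)
  have h1 : Gamma ((k : ℝ) + 3 / 2) ≠ 0 := (Real.Gamma_pos_of_pos (by positivity)).ne'
  rw [show 2 * k + 3 - 1 = 2 * k + 2 by omega]
  simp only [coeffL]
  push_cast
  rw [add_zero, Gamma_add_five_halves]
  field_simp
  ring_nf

theorem risingFactorial_pos {a : ℝ} (ha : 0 < a) (k : ℕ) : 0 < risingFactorial a k :=
  Finset.prod_pos fun i _ => by positivity

theorem risingFactorial_succ (a : ℝ) (k : ℕ) :
    risingFactorial a (k + 1) = risingFactorial a k * (a + k) :=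
  Finset.prod_range_succ _ k

theorem factorial_le_risingFactorial {a : ℝ} (ha : 1 ≤ a) (k : ℕ) :
    (k.factorial : ℝ) ≤ risingFactorial a k := by
  induction k with
  | zero => simp [risingFactorial]
  | succ k ih =>
    rw [risingFactorial_succ, Nat.factorial_succ]
    push_cast
    have : (k : ℝ) + 1 ≤ a + k := by linarith
    rw [mul_comm]
    exact mul_le_mul ih this (by positivity) (risingFactorial_pos (by linarith) k).le

theorem risingFactorial_one (k : ℕ) : risingFactorial 1 k = k.factorial := by
  induction k with
  | zero => simp [risingFactorial]
  | succ k ih => rw [risingFactorial_succ, Nat.factorial_succ, ih]; push_cast; ring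

theorem risingFactorial_two (k : ℕ) : risingFactorial 2 k = (k + 1) * k.factorial := by
  induction k with
  | zero => simp [risingFactorial]
  | succ k ih => rw [risingFactorial_succ, Nat.factorial_succ, ih]; push_cast; ring

theorem risingFactorial_three (k : ℕ) :
    risingFactorial 3 k = (k + 2) * (k + 1) * k.factorial / 2 := by
  induction k with
  | zero => simp [risingFactorial]
  | succ k ih => rw [risingFactorial_succ, Nat.factorial_succ, ih]; push_cast; ring

theorem Gamma_mul_Gamma_eq_risingFactorial (k : ℕ) :
    Gamma ((k : ℝ) + 3 / 2) * Gamma ((k : ℝ) + 1 + 3 / 2) =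
      3 * π / 8 * (risingFactorial (3 / 2) k * risingFactorial (5 / 2) k) := by
  induction k with
  | zero =>
    rw [Gamma_add_five_halves]
    simp only [risingFactorial, Nat.cast_zero, zero_add, Gamma_three_halves, Finset.range_zero,
      Finset.prod_empty]
    have := Real.sq_sqrt Real.pi_pos.le
    nlinarith
  | succ k ih =>
    have h1 := Gamma_add_five_halves (k + 1)
    rw [Gamma_add_five_halves] at ih
    push_cast at h1 ⊢
    rw [h1, Gamma_add_five_halves, risingFactorial_succ, risingFactorial_succ]
    linear_combination (k + 3 / 2) * (k + 1 + 3 / 2) * ih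

theorem hasDerivAt_pow_four_mul_hypergeometric (x : ℝ) :
    HasDerivAt (fun y => y ^ 4 * hypergeometricPFQ [1, 2] [3 / 2, 5 / 2, 3] (y ^ 2 / 4))
      (6 * π * (x * struveL 1 x)) x := by
  let g : ℕ → ℝ := fun k =>
    2 / ((k + 2) * 4 ^ k * (risingFactorial (3 / 2) k * risingFactorial (5 / 2) k))
  have hg : ∀ k, |g k| ≤ 1 / (k.factorial : ℝ) := fun k => by
    have p1 := risingFactorial_pos (show (0 : ℝ) < 3 / 2 by norm_num) k
    have p2 := risingFactorial_pos (show (0 : ℝ) < 5 / 2 by norm_num) k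
    have h1 := factorial_le_risingFactorial (show (1 : ℝ) ≤ 3 / 2 by norm_num) k
    have h2 := factorial_le_risingFactorial (show (1 : ℝ) ≤ 5 / 2 by norm_num) k
    have h3 : (1 : ℝ) ≤ (k.factorial : ℝ) := by exact_mod_cast Nat.factorial_pos _
    have h4 : (1 : ℝ) ≤ 4 ^ k := one_le_pow₀ (by norm_num)
    have h5 : (2 : ℝ) ≤ k + 2 := by linarith [k.cast_nonneg (α := ℝ)]
    rw [abs_of_pos (by positivity)]
    calc g k ≤ 2 / (2 * 1 * (k.factorial * 1)) := by
          simp only [g]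
          gcongr
          exact h3.trans h2
      _ = _ := by field_simp
  have h := hasDerivAt_tsum_of_abs_le_div_factorial hg 4 x
  have e : (fun y : ℝ => y ^ 4 * hypergeometricPFQ [1, 2] [3 / 2, 5 / 2, 3] (y ^ 2 / 4)) =
      fun y => ∑' k, g k * y ^ (2 * k + 4) := by
    funext y
    rw [hypergeometricPFQ, ← tsum_mul_left]
    refine tsum_congr fun k => ?_
    have p1 := (risingFactorial_pos (show (0 : ℝ) < 3 / 2 by norm_num) k).ne'
    have p2 := (risingFactorial_pos (show (0 : ℝ) < 5 / 2 by norm_num) k).ne'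
    have p3 : (k.factorial : ℝ) ≠ 0 := by positivity
    simp only [List.map_cons, List.map_nil, List.prod_cons, List.prod_nil, mul_one,
      risingFactorial_one, risingFactorial_two, risingFactorial_three, g]
    rw [div_pow, ← pow_mul]
    field_simp
    ring
  rw [e, struveL_eq_tsum, ← tsum_mul_left, ← tsum_mul_left]
  refine h.congr_deriv (tsum_congr fun k => ?_)
  have p1 := (risingFactorial_pos (show (0 : ℝ) < 3 / 2 by norm_num) k).ne'
  have p2 := (risingFactorial_pos (show (0 : ℝ) < 5 / 2 by norm_num) k).ne'
  rw [show 2 * k + 4 - 1 = 2 * k + 3 by omega]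
  simp only [coeffL, g, Nat.cast_one]
  rw [Gamma_mul_Gamma_eq_risingFactorial]
  have h4 : (2 : ℝ) ^ (2 * k + 1 + 1) = 4 * 4 ^ k := by
    rw [add_assoc, pow_add, pow_mul]; norm_num [mul_comm]
  rw [h4]
  push_cast
  field_simp
  ring

theorem hasSum_integral_pow_mul_sin {c : ℕ → ℝ} {f : ℝ → ℝ} {e : ℕ → ℕ} (x : ℝ)
    (hc : ∀ k, 0 ≤ c k) (hf : ∀ y, HasSum (fun k => c k * y ^ e k) (f y)) :
    HasSum (fun k => c k * x ^ e k * ∫ θ in (0 : ℝ)..π, sin θ ^ e k)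
      (∫ θ in (0 : ℝ)..π, f (x * sin θ)) := by
  have h := intervalIntegral.hasSum_integral_of_dominated_convergence
    (μ := MeasureTheory.volume) (a := 0) (b := π)
    (F := fun k θ => c k * (x * sin θ) ^ e k) (f := fun θ => f (x * sin θ))
    (fun k _ => c k * |x| ^ e k)
    (fun k => by
      have : Continuous fun θ : ℝ => c k * (x * sin θ) ^ e k := by fun_prop
      exact this.aestronglyMeasurable)
    (fun k => Filter.Eventually.of_forall fun θ _ => by
      rw [Real.norm_eq_abs, abs_mul, abs_of_nonneg (hc k), abs_pow, abs_mul]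
      have : |x| * |sin θ| ≤ |x| := mul_le_of_le_one_right (abs_nonneg x) (abs_sin_le_one θ)
      have := hc k
      gcongr)
    (Filter.Eventually.of_forall fun _ _ => (hf |x|).summable)
    (by simp)
    (Filter.Eventually.of_forall fun θ _ => hf (x * sin θ))
  simpa only [mul_pow, ← mul_assoc, intervalIntegral.integral_const_mul] using h

theorem besselI_zero_eq_integral (x : ℝ) :
    besselI 0 x = (∫ θ in (0 : ℝ)..π, cosh (x * sin θ)) / π := by
  have hf : ∀ y, HasSum (fun k : ℕ => 1 / ((2 * k).factorial : ℝ) * y ^ (2 * k)) (cosh y) :=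
    fun y => by simpa [div_eq_inv_mul] using Real.hasSum_cosh y
  rw [← (hasSum_integral_pow_mul_sin x (fun k => by positivity) hf).tsum_eq, besselI_eq_tsum,
    ← tsum_div_const]
  refine tsum_congr fun k => ?_
  have key : π * ∏ i ∈ Finset.range k, (2 * (i : ℝ) + 1) / (2 * i + 2) =
      π * (2 * k).factorial * coeffI 0 k := by
    induction k with
    | zero => simp [coeffI]
    | succ k ih =>
      rw [Finset.prod_range_succ, ← mul_assoc, ih]
      simp only [coeffI, Nat.factorial_succ, add_zero, mul_add, mul_one]
      push_cast
      field_simp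
      ring
  rw [integral_sin_pow_even, key, add_zero]
  field_simp

theorem struveL_zero_eq_integral (x : ℝ) :
    struveL 0 x = (∫ θ in (0 : ℝ)..π, sinh (x * sin θ)) / π := by
  have hf : ∀ y, HasSum (fun k : ℕ => 1 / ((2 * k + 1).factorial : ℝ) * y ^ (2 * k + 1))
      (sinh y) := fun y => by simpa [div_eq_inv_mul] using Real.hasSum_sinh y
  rw [← (hasSum_integral_pow_mul_sin x (fun k => by positivity) hf).tsum_eq, struveL_eq_tsum,
    ← tsum_div_const]
  refine tsum_congr fun k => ?_
  have key : 2 * ∏ i ∈ Finset.range k, (2 * (i : ℝ) + 2) / (2 * i + 3) =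
      π * (2 * k + 1).factorial * coeffL 0 k := by
    induction k with
    | zero =>
      rw [coeffL_zero_zero]
      simp
      field_simp
    | succ k ih =>
      have h1 : Gamma ((k : ℝ) + 3 / 2) ≠ 0 := (Real.Gamma_pos_of_pos (by positivity)).ne'
      rw [Finset.prod_range_succ, ← mul_assoc, ih]
      simp only [coeffL, Nat.factorial_succ, add_zero, mul_add, mul_one, Nat.cast_add,
        Nat.cast_one, Nat.cast_zero, Gamma_add_five_halves]
      push_cast
      field_simp
      ring
  rw [integral_sin_pow_odd, key, zero_add]
  field_simp

theorem besselI_sub_struveL_zero_mem {x : ℝ} (hx : 0 ≤ x) :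
    besselI 0 x - struveL 0 x ∈ Set.Icc (0 : ℝ) 1 := by
  have e : besselI 0 x - struveL 0 x = (∫ θ in (0 : ℝ)..π, exp (-(x * sin θ))) / π := by
    rw [besselI_zero_eq_integral, struveL_zero_eq_integral, ← sub_div,
      ← intervalIntegral.integral_sub
        (Continuous.intervalIntegrable (by fun_prop) _ _)
        (Continuous.intervalIntegrable (by fun_prop) _ _)]
    simp only [Real.cosh_sub_sinh]
  rw [e]
  constructor
  · exact div_nonneg
      (intervalIntegral.integral_nonneg pi_pos.le fun θ _ => (exp_pos _).le) pi_pos.le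
  · rw [div_le_one pi_pos]
    calc ∫ θ in (0 : ℝ)..π, exp (-(x * sin θ)) ≤ ∫ _ in (0 : ℝ)..π, (1 : ℝ) := by
          refine intervalIntegral.integral_mono_on pi_pos.le
            (Continuous.intervalIntegrable (by fun_prop) _ _) (by simp) fun θ hθ => ?_
          exact exp_le_one_iff.2 (neg_nonpos.2 (mul_nonneg hx (sin_nonneg_of_mem_Icc hθ)))
      _ = π := by simp

theorem continuous_besselI_zero : Continuous (besselI 0) :=
  continuous_iff_continuousAt.2 fun x => (hasDerivAt_besselI_zero x).continuousAt

theorem continuous_struveL_zero : Continuous (struveL 0) :=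
  continuous_iff_continuousAt.2 fun x => (hasDerivAt_struveL_zero x).continuousAt

theorem summable_besselI (ν : ℕ) (x : ℝ) : Summable fun k => coeffI ν k * x ^ (2 * k + ν) :=
  summable_of_abs_le_div_factorial (abs_coeffI_le ν) ν x

theorem besselI_nonneg (ν : ℕ) {x : ℝ} (hx : 0 ≤ x) : 0 ≤ besselI ν x := by
  rw [besselI_eq_tsum]
  exact tsum_nonneg fun k => mul_nonneg (coeffI_nonneg ν k) (by positivity)

theorem besselI_mono (ν : ℕ) {x y : ℝ} (hx : 0 ≤ x) (hxy : x ≤ y) :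
    besselI ν x ≤ besselI ν y := by
  rw [besselI_eq_tsum, besselI_eq_tsum]
  refine (summable_besselI ν x).tsum_le_tsum (fun k => ?_) (summable_besselI ν y)
  have := coeffI_nonneg ν k
  gcongr

theorem besselI_zero_pos {x : ℝ} (hx : 0 ≤ x) : 0 < besselI 0 x := by
  have h : besselI 0 0 = 1 := by
    rw [besselI_eq_tsum, tsum_eq_single 0 fun k hk => by simp [hk]]
    simp [coeffI]
  linarith [besselI_mono 0 le_rfl hx]

theorem besselI_one_le_besselI_zero (x : ℝ) : besselI 1 x ≤ besselI 0 x := by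
  have s0 := summable_besselI 0 x
  have s1 := (summable_nat_add_iff 1).2 s0
  have h : besselI 1 x ≤ (besselI 0 x + ∑' k, coeffI 0 (k + 1) * x ^ (2 * (k + 1) + 0)) / 2 := by
    rw [besselI_eq_tsum, besselI_eq_tsum, ← s0.tsum_add s1, ← tsum_div_const]
    refine (summable_besselI 1 x).tsum_le_tsum (fun k => ?_) ((s0.add s1).div_const 2)
    have h0 : coeffI 0 k * x ^ (2 * k + 0) = (x ^ k / (2 ^ k * k.factorial)) ^ 2 := by
      simp only [coeffI, add_zero]; rw [pow_mul', pow_mul']; field_simp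
    have h1 : coeffI 0 (k + 1) * x ^ (2 * (k + 1) + 0) =
        (x ^ (k + 1) / (2 ^ (k + 1) * (k + 1).factorial)) ^ 2 := by
      simp only [coeffI, add_zero]; rw [pow_mul', pow_mul']; field_simp
    have h2 : coeffI 1 k * x ^ (2 * k + 1) =
        x ^ k / (2 ^ k * k.factorial) * (x ^ (k + 1) / (2 ^ (k + 1) * (k + 1).factorial)) := by
      simp only [coeffI]; field_simp; ring
    rw [h0, h1, h2]
    linarith [two_mul_le_add_sq (x ^ k / (2 ^ k * k.factorial : ℝ))
      (x ^ (k + 1) / (2 ^ (k + 1) * (k + 1).factorial : ℝ))]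
  have h0 : besselI 0 x = 1 + ∑' k, coeffI 0 (k + 1) * x ^ (2 * (k + 1) + 0) := by
    rw [besselI_eq_tsum, s0.tsum_eq_zero_add]
    simp [coeffI]
  linarith

theorem mul_besselI_two (x : ℝ) : x * besselI 2 x = x * besselI 0 x - 2 * besselI 1 x := by
  have s0 := Summable.mul_left x (summable_besselI 0 x)
  have s1 := Summable.mul_left 2 (summable_besselI 1 x)
  have s := s0.sub s1
  rw [besselI_eq_tsum, besselI_eq_tsum, besselI_eq_tsum, ← tsum_mul_left, ← tsum_mul_left,
    ← tsum_mul_left, ← s0.tsum_sub s1, s.tsum_eq_zero_add]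
  have h0 : x * (coeffI 0 0 * x ^ (2 * 0 + 0)) - 2 * (coeffI 1 0 * x ^ (2 * 0 + 1)) = 0 := by
    simp [coeffI]
  rw [h0, zero_add]
  refine tsum_congr fun k => ?_
  simp only [coeffI, Nat.factorial_succ, add_zero]
  push_cast
  field_simp
  ring

theorem abs_besselI_sub_struveL_one_le {x : ℝ} (hx : 0 < x) :
    |besselI 1 x - struveL 1 x| ≤ x := by
  have h := norm_image_sub_le_of_norm_deriv_le_segment'
    (f := fun y => y * besselI 1 y - y * struveL 1 y)
    (f' := fun y => y * besselI 0 y - y * struveL 0 y) (a := 0) (b := x) (C := x)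
    (fun y _ => ((hasDerivAt_mul_besselI_one y).sub (hasDerivAt_mul_struveL_one y)).hasDerivWithinAt)
    (fun y hy => by
      have := besselI_sub_struveL_zero_mem hy.1
      rw [← mul_sub, Real.norm_eq_abs, abs_of_nonneg (mul_nonneg hy.1 this.1)]
      nlinarith [this.1, this.2, hy.1, hy.2]) x ⟨hx.le, le_rfl⟩
  simp only [zero_mul, sub_zero, ← mul_sub, Real.norm_eq_abs, abs_mul, abs_of_pos hx] at h
  exact le_of_mul_le_mul_left h hx

theorem mul_upsilon (x : ℝ) :
    x * upsilon x = 2 / π * (x * besselI 0 x - ∫ t in (0 : ℝ)..x, besselI 0 t) := by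
  have hJ (y : ℝ) : HasDerivAt (fun y => ∫ t in (0 : ℝ)..y, besselI 0 t) (besselI 0 y) y :=
    continuous_besselI_zero.integral_hasStrictDerivAt 0 y |>.hasDerivAt
  have hd (y : ℝ) : HasDerivAt (fun y => y * besselI 1 y * struveL 0 y -
      besselI 0 y * (y * struveL 1 y) -
      2 / π * (y * besselI 0 y - ∫ t in (0 : ℝ)..y, besselI 0 t)) 0 y := by
    refine ((((hasDerivAt_mul_besselI_one y).mul (hasDerivAt_struveL_zero y)).sub
      ((hasDerivAt_besselI_zero y).mul (hasDerivAt_mul_struveL_one y))).sub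
      ((((hasDerivAt_id y).mul (hasDerivAt_besselI_zero y)).sub (hJ y)).const_mul
        (2 / π))).congr_deriv ?_
    simp only [id]
    ring
  have h := is_const_of_deriv_eq_zero (fun y => (hd y).differentiableAt)
    (fun y => (hd y).deriv) x 0
  simp only [zero_mul, mul_zero, sub_zero, intervalIntegral.integral_same] at h
  rw [upsilon]
  linear_combination h

theorem pow_four_mul_hypergeometric (x : ℝ) :
    x ^ 4 * hypergeometricPFQ [1, 2] [3 / 2, 5 / 2, 3] (x ^ 2 / 4) =
      6 * π * (x * struveL 0 x - (∫ t in (0 : ℝ)..x, struveL 0 t) - x ^ 2 / π) := by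
  have hK (y : ℝ) : HasDerivAt (fun y => ∫ t in (0 : ℝ)..y, struveL 0 t) (struveL 0 y) y :=
    continuous_struveL_zero.integral_hasStrictDerivAt 0 y |>.hasDerivAt
  have hd (y : ℝ) : HasDerivAt (fun y =>
      y ^ 4 * hypergeometricPFQ [1, 2] [3 / 2, 5 / 2, 3] (y ^ 2 / 4) -
      6 * π * (y * struveL 0 y - (∫ t in (0 : ℝ)..y, struveL 0 t) - y ^ 2 / π)) 0 y := by
    refine ((hasDerivAt_pow_four_mul_hypergeometric y).sub
      (((((hasDerivAt_id y).mul (hasDerivAt_struveL_zero y)).sub (hK y)).sub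
        ((hasDerivAt_pow 2 y).div_const π)).const_mul (6 * π))).congr_deriv ?_
    simp only [id]
    field_simp
    ring
  have h := is_const_of_deriv_eq_zero (fun y => (hd y).differentiableAt)
    (fun y => (hd y).deriv) x 0
  simp at h
  linear_combination h

open Filter Topology

theorem integral_besselI_zero_mem {x : ℝ} (hx : 0 ≤ x) :
    (∫ t in (0 : ℝ)..x, besselI 0 t) ∈ Set.Icc 0 (x * besselI 0 x) := by
  constructor
  · exact intervalIntegral.integral_nonneg hx fun t ht => besselI_nonneg 0 ht.1
  · calc (∫ t in (0 : ℝ)..x, besselI 0 t) ≤ ∫ _ in (0 : ℝ)..x, besselI 0 x :=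
          intervalIntegral.integral_mono_on hx
            (continuous_besselI_zero.intervalIntegrable _ _) (by simp)
            fun t ht => besselI_mono 0 ht.1 ht.2
      _ = x * besselI 0 x := by simp

theorem integral_besselI_sub_struveL_zero_mem {x : ℝ} (hx : 0 ≤ x) :
    (∫ t in (0 : ℝ)..x, (besselI 0 t - struveL 0 t)) ∈ Set.Icc 0 x := by
  constructor
  · exact intervalIntegral.integral_nonneg hx fun t ht => (besselI_sub_struveL_zero_mem ht.1).1
  · calc (∫ t in (0 : ℝ)..x, (besselI 0 t - struveL 0 t)) ≤ ∫ _ in (0 : ℝ)..x, (1 : ℝ) :=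
          intervalIntegral.integral_mono_on hx
            ((continuous_besselI_zero.sub continuous_struveL_zero).intervalIntegrable _ _) (by simp)
            fun t ht => (besselI_sub_struveL_zero_mem ht.1).2
      _ = x := by simp

theorem upsilon_mem {x : ℝ} (hx : 0 < x) : upsilon x ∈ Set.Icc 0 (besselI 0 x) := by
  have h := mul_upsilon x
  have hJ := integral_besselI_zero_mem hx.le
  have hp : 2 / π ≤ 1 := by rw [div_le_one pi_pos]; linarith [pi_gt_three]
  have hp0 : 0 < 2 / π := by positivity
  constructor
  · refine nonneg_of_mul_nonneg_right (a := x) ?_ hx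
    rw [h]
    exact mul_nonneg hp0.le (sub_nonneg.2 hJ.2)
  · refine le_of_mul_le_mul_left ?_ hx
    rw [h]
    nlinarith [hJ.1, hJ.2, mul_nonneg hx.le (besselI_nonneg 0 hx.le)]

/-- The two exponentially large terms of `lambdaStar` cancel up to `O(x⁻²)`. -/
theorem abs_hypergeometric_sub_le {x : ℝ} (hx : 0 < x) :
    |3 * hypergeometricPFQ [1, 2] [3 / 2, 5 / 2, 3] (x ^ 2 / 4)
      - 9 * π ^ 2 * struveL 0 x * upsilon x / (x ^ 3 * besselI 0 x)| ≤
      18 / x ^ 2 + 18 * π / x ^ 3 := by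
  have hI := besselI_zero_pos hx.le
  have hF := pow_four_mul_hypergeometric x
  have hU := mul_upsilon x
  have hJ := integral_besselI_zero_mem hx.le
  have hM := integral_besselI_sub_struveL_zero_mem hx.le
  have hm := besselI_sub_struveL_zero_mem hx.le
  rw [intervalIntegral.integral_sub (continuous_besselI_zero.intervalIntegrable _ _)
    (continuous_struveL_zero.intervalIntegrable _ _)] at hM
  set J := ∫ t in (0 : ℝ)..x, besselI 0 t
  set K := ∫ t in (0 : ℝ)..x, struveL 0 t
  set F := hypergeometricPFQ [1, 2] [3 / 2, 5 / 2, 3] (x ^ 2 / 4)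
  set q := (besselI 0 x - struveL 0 x) * J / besselI 0 x with hq
  have hq0 : 0 ≤ q := div_nonneg (mul_nonneg hm.1 hJ.1) hI.le
  have hqx : q ≤ x := by
    rw [hq, div_le_iff₀ hI]
    nlinarith [hm.1, hm.2, hJ.1, hJ.2]
  have hF' : F = 6 * π * (x * struveL 0 x - K - x ^ 2 / π) / x ^ 4 := by
    rw [eq_div_iff (by positivity), mul_comm, hF]
  have hU' : upsilon x = 2 / π * (x * besselI 0 x - J) / x := by
    rw [eq_div_iff hx.ne', mul_comm, hU]
  have e : 3 * F - 9 * π ^ 2 * struveL 0 x * upsilon x / (x ^ 3 * besselI 0 x) =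
      18 * π / x ^ 4 * ((J - K) - q) - 18 / x ^ 2 := by
    rw [hF', hU', hq]
    field_simp
    ring
  rw [e]
  have h1 : |J - K - q| ≤ x := abs_le.2 ⟨by linarith [hM.1], by linarith [hM.2]⟩
  calc |18 * π / x ^ 4 * ((J - K) - q) - 18 / x ^ 2|
      ≤ |18 * π / x ^ 4 * ((J - K) - q)| + |18 / x ^ 2| := abs_sub _ _
    _ = 18 * π / x ^ 4 * |(J - K) - q| + 18 / x ^ 2 := by
        rw [abs_mul, abs_of_pos (a := 18 * π / x ^ 4) (by positivity),
          abs_of_pos (a := 18 / x ^ 2) (by positivity)]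
    _ ≤ 18 * π / x ^ 4 * x + 18 / x ^ 2 := by gcongr
    _ = _ := by field_simp; ring

theorem tendsto_const_div_pow_atTop (c : ℝ) {n : ℕ} (hn : n ≠ 0) :
    Tendsto (fun x : ℝ => c / x ^ n) atTop (𝓝 0) :=
  tendsto_const_nhds.div_atTop (tendsto_pow_atTop hn)

theorem tendsto_zero_of_abs_le_div {f : ℝ → ℝ} {n : ℕ} (hn : n ≠ 0) (c : ℝ)
    (h : ∀ x, 0 < x → |f x| ≤ c / x ^ n) : Tendsto f atTop (𝓝 0) :=
  squeeze_zero_norm' ((eventually_gt_atTop 0).mono h) (tendsto_const_div_pow_atTop c hn)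

theorem tendsto_upsilon_div :
    Tendsto (fun x => upsilon x / (x ^ 2 * besselI 0 x)) atTop (𝓝 0) := by
  refine tendsto_zero_of_abs_le_div two_ne_zero 1 fun x hx => ?_
  have hI := besselI_zero_pos hx.le
  have hU := upsilon_mem hx
  rw [abs_of_nonneg (div_nonneg hU.1 (by positivity)),
    div_le_div_iff₀ (by positivity) (by positivity)]
  nlinarith [hU.2, pow_pos hx 2]

theorem tendsto_besselI_one_div :
    Tendsto (fun x => besselI 1 x / (x * besselI 0 x)) atTop (𝓝 0) := by
  refine tendsto_zero_of_abs_le_div one_ne_zero 1 fun x hx => ?_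
  have hI := besselI_zero_pos hx.le
  rw [abs_of_nonneg (div_nonneg (besselI_nonneg 1 hx.le) (by positivity)), pow_one,
    div_le_div_iff₀ (by positivity) hx]
  nlinarith [besselI_one_le_besselI_zero x]

theorem tendsto_dZero_sq : Tendsto (fun x => dZero (x ^ 2)) atTop (𝓝 (2 / 3)) := by
  have h := (((tendsto_upsilon_div.const_mul (3 * π)).add_const 2).sub
    (tendsto_besselI_one_div.const_mul 6)).div
    (((tendsto_besselI_one_div.const_mul 2).const_sub 1).const_mul 3) (by norm_num)
  norm_num at h
  refine h.congr' ((eventually_gt_atTop 0).mono fun x hx => ?_)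
  have hI := besselI_zero_pos hx.le
  have h2 : besselI 2 x = besselI 0 x - 2 * besselI 1 x / x := by
    have := mul_besselI_two x
    field_simp
    linarith
  have e : 3 * x ^ 2 * besselI 2 x =
      3 * (1 - 2 * (besselI 1 x / (x * besselI 0 x))) * (x ^ 2 * besselI 0 x) := by
    rw [h2]; field_simp
  have e' : 3 * π * upsilon x + 2 * x ^ 2 * besselI 0 x - 6 * x * besselI 1 x =
      (3 * π * (upsilon x / (x ^ 2 * besselI 0 x)) + 2 - 6 * (besselI 1 x / (x * besselI 0 x))) *
        (x ^ 2 * besselI 0 x) := by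
    field_simp
  simp only [Pi.div_apply]
  rw [dZero, sqrt_sq hx.le, e, e', mul_div_mul_right _ _ (by positivity)]

theorem tendsto_lambdaStar_sq (V : ℝ) :
    Tendsto (fun x => lambdaStar V (x ^ 2)) atTop (𝓝 (18 * V / π)) := by
  have hF : Tendsto (fun x => 3 * hypergeometricPFQ [1, 2] [3 / 2, 5 / 2, 3] (x ^ 2 / 4)
      - 9 * π ^ 2 * struveL 0 x * upsilon x / (x ^ 3 * besselI 0 x)) atTop (𝓝 0) := by
    refine squeeze_zero_norm' ((eventually_gt_atTop 0).mono fun x hx =>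
      abs_hypergeometric_sub_le hx) ?_
    simpa using (tendsto_const_div_pow_atTop 18 two_ne_zero).add
      (tendsto_const_div_pow_atTop (18 * π) three_ne_zero)
  have h := (((((tendsto_dZero_sq.const_mul 6).sub_const 3).add
    (((tendsto_dZero_sq.const_sub 1).mul tendsto_upsilon_div).const_mul (18 * π))).add hF).inv₀
      (by norm_num)).const_mul (18 * V / π)
  norm_num at h
  refine h.congr' ((eventually_gt_atTop 0).mono fun x hx => ?_)
  have hB : (x ^ 2) ^ (3 / 2 : ℝ) = x ^ 3 := by
    rw [← rpow_natCast x 2, ← rpow_natCast x 3, ← rpow_mul hx.le]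
    norm_num
  simp only [lambdaStar]
  rw [sqrt_sq hx.le, hB]
  congr 2
  ring

theorem tendsto_besselI_one_mul_div {r : ℝ} (hr : r ∈ Set.Icc (0 : ℝ) 1) :
    Tendsto (fun x => besselI 1 (x * r) / (x * besselI 0 x)) atTop (𝓝 0) := by
  refine squeeze_zero' ((eventually_gt_atTop 0).mono fun x hx => ?_)
    ((eventually_gt_atTop 0).mono fun x hx => ?_) tendsto_besselI_one_div
  · have hI := besselI_zero_pos hx.le
    exact div_nonneg (besselI_nonneg 1 (mul_nonneg hx.le hr.1)) (by positivity)
  · have hI := besselI_zero_pos hx.le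
    have := besselI_mono 1 (mul_nonneg hx.le hr.1) (mul_le_of_le_one_right hx.le hr.2)
    gcongr

theorem tendsto_struveL_one_sub_div {r : ℝ} (hr : r ∈ Set.Icc (0 : ℝ) 1) :
    Tendsto (fun x => (struveL 1 (x * r) - struveL 0 x * besselI 1 (x * r) / besselI 0 x) / x ^ 2)
      atTop (𝓝 0) := by
  have hN : Tendsto (fun x => (besselI 1 (x * r) - struveL 1 (x * r)) / x ^ 2) atTop (𝓝 0) := by
    refine tendsto_zero_of_abs_le_div one_ne_zero 1 fun x hx => ?_
    have h : |besselI 1 (x * r) - struveL 1 (x * r)| ≤ x := by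
      rcases hr.1.eq_or_lt with rfl | h0
      · simp [besselI_eq_tsum, struveL_eq_tsum, hx.le]
      · exact (abs_besselI_sub_struveL_one_le (mul_pos hx h0)).trans
          (mul_le_of_le_one_right hx.le hr.2)
    rw [abs_div, abs_of_pos (a := x ^ 2) (by positivity), pow_one,
      div_le_div_iff₀ (by positivity) hx]
    nlinarith
  have hM : Tendsto (fun x => (besselI 0 x - struveL 0 x) / x) atTop (𝓝 0) := by
    refine tendsto_zero_of_abs_le_div one_ne_zero 1 fun x hx => ?_
    have h := besselI_sub_struveL_zero_mem hx.le
    rw [abs_of_nonneg (div_nonneg h.1 hx.le), pow_one]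
    have := h.2
    gcongr
  have h := (hM.mul (tendsto_besselI_one_mul_div hr)).sub hN
  rw [mul_zero, sub_zero] at h
  refine h.congr' ((eventually_gt_atTop 0).mono fun x hx => ?_)
  have hI := besselI_zero_pos hx.le
  field_simp
  ring

theorem tendsto_hStar_sq (V : ℝ) {r : ℝ} (hr : r ∈ Set.Icc (0 : ℝ) 1) :
    Tendsto (fun x => hStar V (x ^ 2) r) atTop (𝓝 (6 * V * (r - r ^ 2) / π)) := by
  have hl := tendsto_lambdaStar_sq V
  have hd := tendsto_dZero_sq
  have h := (((hl.div_const 3).mul ((((hd.const_mul 3).mul_const r).div_const 2).sub_const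
    (r ^ 2))).add ((hl.mul (hd.const_sub 1)).mul (tendsto_besselI_one_mul_div hr))).add
    (((hl.mul_const π).div_const 2).mul (tendsto_struveL_one_sub_div hr))
  rw [show 18 * V / π / 3 * (3 * (2 / 3) * r / 2 - r ^ 2) + 18 * V / π * (1 - 2 / 3) * 0 +
    18 * V / π * π / 2 * 0 = 6 * V * (r - r ^ 2) / π by ring] at h
  refine h.congr' ((eventually_gt_atTop 0).mono fun x hx => ?_)
  simp only [hStar]
  rw [sqrt_sq hx.le]
  ring

theorem tendsto_of_tendsto_comp_sq {f : ℝ → ℝ} {l : Filter ℝ}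
    (h : Tendsto (fun x => f (x ^ 2)) atTop l) : Tendsto f atTop l :=
  (h.comp tendsto_sqrt_atTop).congr' ((eventually_ge_atTop 0).mono fun x hx => by
    simp [sq_sqrt hx])

end Sloshing

end

theorem mainTheorem9 (V : ℝ) (hV : 0 < V) :
    Filter.Tendsto (fun B : ℝ => Sloshing.lambdaStar V B) Filter.atTop
        (nhds (18 * V / Real.pi)) ∧
      ∀ r ∈ Set.Icc (0 : ℝ) 1,
        Filter.Tendsto (fun B : ℝ => Sloshing.hStar V B r) Filter.atTop
          (nhds (6 * V * (r - r ^ 2) / Real.pi)) :=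
  ⟨Sloshing.tendsto_of_tendsto_comp_sq (Sloshing.tendsto_lambdaStar_sq V),
    fun _ hr => Sloshing.tendsto_of_tendsto_comp_sq (Sloshing.tendsto_hStar_sq V hr)⟩
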